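/- Fix functions $\ell:\mathbb N\to\mathbb N$ and $\delta:\mathbb N\to\mathbb R$, and let $\mathbf X=\{X_\lambda\}_{\lambda\in\mathbb N}$ be an arbitrary ensemble, where $X_\lambda$ is a probability distribution on $\{0,1\}^{\ell(\lambda)}$ (not necessarily efficiently samplable). A QPT algorithm $A$ with quantum advice consists of an advice state (density matrix) $\rho_\lambda$ for each security parameter $\lambda$ and, for each $\lambda$ and each input length $n$, a quantum circuit over the gate set $\{H,T,X,\mathrm{CNOT}\}$ with read access to $n$ classical input bits; the circuit acts on $\rho_\lambda$ and ancilla qubits $|0\rangle$ and outputs one measured bit. The number of qubits plus the number of gates (reading an input bit counts as a gate) is bounded by a polynomial in $\lambda$. We write $A(w)$ for the output bit of $A$ on security parameter $\lambda$ and input $w$. Let $U_\lambda$ be the uniform distribution on $\{0,1\}^{\ell(\lambda)}$, and for $y\in\{0,1\}^{\ell(\lambda)}$ and $1\le i\le\ell(\lambda)$ let $y_{<i}\in\{0,1\}^{i-1}$ denote the bits of $y$ before the $i$-th bit $y_i$. Then the following holds, both when every inequality below is required for all $\lambda$ and when every inequality is required for all sufficiently large $\lambda$ (where the threshold may depend on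 the algorithm, but not on $i$). 1. Suppose that every QPT algorithm $A$ with quantum advice satisfies $$\bigl|\Pr[y\leftarrow X_\lambda: A(y)=1]-\Pr[y\leftarrow U_\lambda: A(y)=1]\bigr|\le\delta(\lambda).$$ Then every QPT algorithm $B$ with quantum advice satisfies, for every $1\le i\le\ell(\lambda)$, $$\Pr[y\leftarrow X_\lambda,\ y'\leftarrow B(y_{<i}): y'=y_i]\le\tfrac12+\delta(\lambda).$$ 2. Suppose that every QPT algorithm $A$ with quantum advice satisfies, for every $1\le i\le\ell(\lambda)$, $$\Pr[y\leftarrow X_\lambda,\ y'\leftarrow A(y_{<i}): y'=y_i]\le\tfrac12+\delta(\lambda).$$ Then every QPT algorithm $B$ with quantum advice satisfies $$\bigl|\Pr[y\leftarrow X_\lambda: B(y)=1]-\Pr[y\leftarrow U_\lambda: B(y)=1]\bigr|\le\ell(\lambda)\cdot\delta(\lambda).$$ -/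

import Mathlib

open Matrix Filter
open scoped ComplexOrder

/-- Bit strings of length `n`. -/
abbrev Bits (n : ℕ) : Type := Fin n → Bool

/-- Instructions of a quantum circuit that has a classical read-only input of `n` bits and
works on qubits labelled by `Q`: the gates `H`, `T`, `X`, `CNOT` (a universal gate set), and
`read j q`, which adds the input bit `j` to the qubit `q` (that is, applies `X` to `q` if and only
if the input bit `j` is `1`). -/
inductive Gate (n : ℕ) (Q : Type) : Type where
  | hadamard (q : Q) : Gate n Q
  | phaseT (q : Q) : Gate n Q
  | flip (q : Q) : Gate n Q
  | cnot (control target : Q) (distinct : control ≠ target) : Gate n Q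
  | read (j : Fin n) (q : Q) : Gate n Q

/-- Operators on the state space of qubits labelled by `Q`, in the computational basis. -/
abbrev QOp (Q : Type) : Type := Matrix (Q → Bool) (Q → Bool) ℂ

section Unitaries

variable {Q : Type} [Fintype Q] [DecidableEq Q]

/-- The one-qubit operator `M` applied to the qubit `q` (identity on all other qubits). -/
def onQubit (q : Q) (M : Matrix Bool Bool ℂ) : QOp Q :=
  fun x y => if ∀ r, r ≠ q → x r = y r then M (x q) (y q) else 0

/-- `1/√2 * [[1, 1], [1, -1]]`. -/
noncomputable def hadamardMatrix : Matrix Bool Bool ℂ :=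
  fun a b => ((Real.sqrt 2 : ℝ) : ℂ)⁻¹ * (if a && b then -1 else 1)

/-- `diag(1, exp(iπ/4))`. -/
noncomputable def phaseTMatrix : Matrix Bool Bool ℂ :=
  Matrix.diagonal fun b => if b then Complex.exp (Complex.I * Real.pi / 4) else 1

/-- Bit flip. -/
def flipMatrix : Matrix Bool Bool ℂ :=
  fun a b => if a = !b then 1 else 0

/-- `|y⟩ ↦ |y with bit t replaced by y_t ⊕ y_c⟩`. -/
def cnotOp (c t : Q) : QOp Q :=
  fun x y => if x = Function.update y t (xor (y t) (y c)) then 1 else 0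

/-- The unitary applied by an instruction when the classical input is `w`. -/
noncomputable def Gate.unitary {n : ℕ} (w : Bits n) : Gate n Q → QOp Q
  | .hadamard q => onQubit q hadamardMatrix
  | .phaseT q => onQubit q phaseTMatrix
  | .flip q => onQubit q flipMatrix
  | .cnot c t _ => cnotOp c t
  | .read j q => if w j then onQubit q flipMatrix else 1

/-- The unitary of a list of instructions; the head of the list is applied first. -/
noncomputable def gatesUnitary {n : ℕ} (w : Bits n) : List (Gate n Q) → QOp Q
  | [] => 1
  | g :: gs => gatesUnitary w gs * g.unitary w

end Unitaries

/-- A (mixed) quantum state of `a` qubits: a density matrix. -/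
structure QState (a : ℕ) : Type where
  mat : QOp (Fin a)
  posSemidef : mat.PosSemidef
  trace_eq_one : mat.trace = 1

/-- A quantum circuit with an `n`-bit classical input, an advice register of `a` qubits, a number
of ancilla qubits initialised to `|0⟩`, and one output qubit, which is measured at the end. -/
structure QCircuit (n a : ℕ) : Type where
  ancillas : ℕ
  gates : List (Gate n (Fin a ⊕ Fin ancillas))
  output : Fin a ⊕ Fin ancillas

namespace QCircuit

variable {n a : ℕ}

/-- Number of instructions plus number of qubits. -/
def size (C : QCircuit n a) : ℕ := C.gates.length + a + C.ancillas

/-- The initial state `ρ ⊗ |0⋯0⟩⟨0⋯0|`. -/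
def initialState (C : QCircuit n a) (ρ : QState a) : QOp (Fin a ⊕ Fin C.ancillas) :=
  fun x y =>
    if (∀ r, x (Sum.inr r) = false) ∧ (∀ r, y (Sum.inr r) = false) then
      ρ.mat (fun q => x (Sum.inl q)) (fun q => y (Sum.inl q))
    else 0

/-- The final state `U (ρ ⊗ |0⋯0⟩⟨0⋯0|) U†` on classical input `w`. -/
noncomputable def finalState (C : QCircuit n a) (ρ : QState a) (w : Bits n) :
    QOp (Fin a ⊕ Fin C.ancillas) :=
  gatesUnitary w C.gates * C.initialState ρ * (gatesUnitary w C.gates)ᴴ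

/-- Born rule: `Pr[C(ρ, w) = b]`, the output qubit being measured in the computational basis. -/
noncomputable def prob (C : QCircuit n a) (ρ : QState a) (w : Bits n) (b : Bool) : ℝ :=
  ∑ x : Fin a ⊕ Fin C.ancillas → Bool,
    if x C.output = b then (C.finalState ρ w x x).re else 0

end QCircuit

/-- A QPT algorithm with quantum advice and one output bit, given by its circuit implementations:
for every security parameter `k` an advice state, and for every `k` and every input length `n` a
circuit that runs on this advice state and on `n` classical input bits. The number of advice qubits
and the circuit sizes are bounded by a polynomial in `k`. -/
structure QPTAlgorithm : Type where
  adviceQubits : ℕ → ℕ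
  advice : ∀ k, QState (adviceQubits k)
  circuit : ∀ k n : ℕ, QCircuit n (adviceQubits k)
  polynomial_size : ∃ p : Polynomial ℕ, ∀ k n, (circuit k n).size ≤ p.eval k

/-- `Pr[A(1^k, w) = b]`. -/
noncomputable def QPTAlgorithm.prob (A : QPTAlgorithm) (k : ℕ) {n : ℕ} (w : Bits n) (b : Bool) : ℝ :=
  (A.circuit k n).prob (A.advice k) w b

/-- A probabilistic ensemble on `{0,1}^ℓ(k)`: any sequence of distributions. -/
abbrev Ensemble (ℓ : ℕ → ℕ) : Type := ∀ k, PMF (Bits (ℓ k))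

/-- `Pr[y ← D : A(1^k, y) = 1]`. -/
noncomputable def acceptProb (A : QPTAlgorithm) (k : ℕ) {n : ℕ} (D : PMF (Bits n)) : ℝ :=
  ∑ y : Bits n, (D y).toReal * A.prob k y true

/-- `|Pr[y ← D : A(1^k, y) = 1] - Pr[y ← {0,1}^n uniform : A(1^k, y) = 1]|`. -/
noncomputable def advantage (A : QPTAlgorithm) (k : ℕ) {n : ℕ} (D : PMF (Bits n)) : ℝ :=
  |acceptProb A k D - acceptProb A k (PMF.uniformOfFintype (Bits n))|

/-- The bits of `y` strictly before position `i`. -/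
def bitsBefore {n : ℕ} (y : Bits n) (i : Fin n) : Bits i.val :=
  fun j => y (Fin.castLE i.isLt.le j)

/-- `Pr[y ← D, y' ← A(1^k, bits of y before position i) : y' = y_i]`. -/
noncomputable def guessProb (A : QPTAlgorithm) (k : ℕ) {n : ℕ} (D : PMF (Bits n)) (i : Fin n) : ℝ :=
  ∑ y : Bits n, (D y).toReal * A.prob k (bitsBefore y i) (y i)

/-- Every QPT algorithm with quantum advice has distinguishing advantage at most `ε k` between the
ensemble and the uniform distribution, for `L`-eventually all `k` (`L = ⊤`: for all `k`;
`L = atTop`: for all sufficiently large `k`). -/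
def PseudorandomWithin (L : Filter ℕ) {ℓ : ℕ → ℕ} (X : Ensemble ℓ) (ε : ℕ → ℝ) : Prop :=
  ∀ A : QPTAlgorithm, ∀ᶠ k in L, advantage A k (X k) ≤ ε k

/-- Every QPT algorithm with quantum advice predicts every next bit with probability at most
`1/2 + ε k`, for `L`-eventually all `k`. -/
def NextBitUnpredictableWithin (L : Filter ℕ) {ℓ : ℕ → ℕ} (X : Ensemble ℓ) (ε : ℕ → ℝ) : Prop :=
  ∀ A : QPTAlgorithm, ∀ᶠ k in L, ∀ i : Fin (ℓ k), guessProb A k (X k) i ≤ 1 / 2 + ε k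

/-! Both directions follow Yao. A predictor for bit `i` becomes a test that asks whether the
predicted bit is correct; its acceptance probability is the guessing probability, which is exactly
1/2 on uniform strings (`guessProb_uniform`).

Conversely, a distinguisher is run on hybrids: a prefix of `y` completed by a string `r`. The
predictor outputs `r i` if the distinguisher accepts and `!r i` otherwise. Averaged over `r`, it
succeeds with probability 1/2 plus the gap between neighbouring hybrids (`average_predictorProb`),
and the gaps telescope.

Circuits are nonuniform, so the best position, or the best `r` and negation bit, is hardwired for
each security parameter. No randomness is needed, and a single algorithm serves all `i`, which makes
the threshold independent of `i`.

The quantum model enters only through three facts: the two outcome probabilities sum to 1, input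
bits can be rewired or fixed, and the output can be negated or XORed with an input bit. -/

section Unitarity

/-! ### Gates are isometries; flipping the measured qubit. -/

variable {Q : Type} [Fintype Q] [DecidableEq Q]

theorem onQubit_conjTranspose (q : Q) (M : Matrix Bool Bool ℂ) :
    (onQubit q M)ᴴ = onQubit q Mᴴ := by
  ext x y
  simp only [conjTranspose_apply, onQubit, eq_comm (a := y _)]
  split_ifs <;> simp

theorem onQubit_one (q : Q) : onQubit q (1 : Matrix Bool Bool ℂ) = 1 := by
  ext x y
  simp only [onQubit, one_apply]
  by_cases h : x = y
  · simp [h]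
  · rw [if_neg h]
    split_ifs with h1 h2
    · refine absurd (funext fun r => ?_) h
      by_cases hr : r = q
      · rw [hr, h2]
      · exact h1 r hr
    · rfl
    · rfl

theorem onQubit_mul (q : Q) (M N : Matrix Bool Bool ℂ) :
    onQubit q M * onQubit q N = onQubit q (M * N) := by
  ext x y
  rw [mul_apply]
  -- Only the two intermediate basis states that agree with `x` off `q` contribute.
  have key : ∀ z, z ∉ Finset.univ.image (fun b : Bool => Function.update x q b) →
      onQubit q M x z * onQubit q N z y = 0 := by
    intro z hz
    have : ¬ ∀ r, r ≠ q → x r = z r := by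
      intro h
      refine hz (Finset.mem_image.2 ⟨z q, Finset.mem_univ _, funext fun r => ?_⟩)
      by_cases hr : r = q
      · subst hr; simp
      · simp [hr, h r hr]
    simp [onQubit, this]
  rw [← Finset.sum_subset (Finset.subset_univ _) (fun z _ hz => key z hz),
    Finset.sum_image (fun a _ b _ h => by simpa using congrFun h q)]
  have h1 : ∀ b, onQubit q M x (Function.update x q b) = M (x q) b := by
    intro b
    have : ∀ r, r ≠ q → x r = Function.update x q b r := fun r hr => by simp [hr]
    simp only [onQubit, if_pos this, Function.update_self]
  have h2 : ∀ b, onQubit q N (Function.update x q b) y =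
      if ∀ r, r ≠ q → x r = y r then N b (y q) else 0 := by
    intro b
    have : (∀ r, r ≠ q → Function.update x q b r = y r) ↔ ∀ r, r ≠ q → x r = y r :=
      forall_congr' fun r => imp_congr_right fun hr => by simp [hr]
    simp only [onQubit, this, Function.update_self]
  simp only [h1, h2]
  simp only [onQubit, mul_apply]
  split_ifs <;> simp

theorem onQubit_isometry (q : Q) {M : Matrix Bool Bool ℂ} (hM : Mᴴ * M = 1) :
    (onQubit q M)ᴴ * onQubit q M = 1 := by
  rw [onQubit_conjTranspose, onQubit_mul, hM, onQubit_one]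

theorem hadamardMatrix_isometry : hadamardMatrixᴴ * hadamardMatrix = 1 := by
  have h2 : ((Real.sqrt 2 : ℝ) : ℂ) * ((Real.sqrt 2 : ℝ) : ℂ) = 2 := by
    rw [← Complex.ofReal_mul, Real.mul_self_sqrt (by norm_num)]; norm_num
  have h3 : ((Real.sqrt 2 : ℝ) : ℂ)⁻¹ * ((Real.sqrt 2 : ℝ) : ℂ)⁻¹ = 1 / 2 := by
    rw [← mul_inv, h2]; norm_num
  ext a b
  cases a <;> cases b <;>
    simp [mul_apply, hadamardMatrix, h3]; norm_num

theorem phaseTMatrix_isometry : phaseTMatrixᴴ * phaseTMatrix = 1 := by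
  rw [phaseTMatrix, diagonal_conjTranspose, diagonal_mul_diagonal, ← diagonal_one]
  congr 1
  ext b
  cases b
  · simp
  · simp only [Pi.star_apply, if_true, Complex.star_def]
    rw [← Complex.exp_conj, ← Complex.exp_add]
    simp only [map_div₀, map_mul, Complex.conj_I, Complex.conj_ofReal]
    rw [show (starRingEnd ℂ) 4 = 4 from Complex.conj_ofNat 4]
    rw [← Complex.exp_zero]
    congr 1
    ring

theorem flipMatrix_isometry : flipMatrixᴴ * flipMatrix = 1 := by
  ext a b
  cases a <;> cases b <;> simp [mul_apply, flipMatrix]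

/-- The matrix permutes the basis by an involution: the control bit is unchanged because `c ≠ t`, so
a second application undoes the first. -/
theorem cnotOp_isometry {c t : Q} (h : c ≠ t) : (cnotOp c t)ᴴ * cnotOp c t = 1 := by
  have inj : Function.Injective
      (fun y : Q → Bool => Function.update y t (xor (y t) (y c))) := by
    refine Function.LeftInverse.injective
      (g := fun y : Q → Bool => Function.update y t (xor (y t) (y c))) fun y => ?_
    simp [h]
  ext x y
  simp only [mul_apply, conjTranspose_apply, cnotOp, one_apply]
  rw [Finset.sum_eq_single (Function.update y t (xor (y t) (y c)))]
  · by_cases hxy : x = y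
    · simp [hxy]
    · have := inj.ne hxy
      simp [hxy, this.symm]
  · intro z _ hz
    simp [hz]
  · simp

theorem Gate.unitary_isometry {n : ℕ} (w : Bits n) (g : Gate n Q) :
    (g.unitary w)ᴴ * g.unitary w = 1 := by
  cases g with
  | hadamard q => exact onQubit_isometry q hadamardMatrix_isometry
  | phaseT q => exact onQubit_isometry q phaseTMatrix_isometry
  | flip q => exact onQubit_isometry q flipMatrix_isometry
  | cnot c t h => exact cnotOp_isometry h
  | read j q =>
    simp only [Gate.unitary]
    split_ifs
    · exact onQubit_isometry q flipMatrix_isometry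
    · simp

theorem gatesUnitary_isometry {n : ℕ} (w : Bits n) (gs : List (Gate n Q)) :
    (gatesUnitary w gs)ᴴ * gatesUnitary w gs = 1 := by
  induction gs with
  | nil => simp [gatesUnitary]
  | cons g gs ih =>
    rw [gatesUnitary, conjTranspose_mul, Matrix.mul_assoc, ← Matrix.mul_assoc _ _ (g.unitary w),
      ih, Matrix.one_mul, Gate.unitary_isometry]

theorem gatesUnitary_append {n : ℕ} (w : Bits n) (gs hs : List (Gate n Q)) :
    gatesUnitary w (gs ++ hs) = gatesUnitary w hs * gatesUnitary w gs := by
  induction gs with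
  | nil => simp [gatesUnitary]
  | cons g gs ih => simp [gatesUnitary, ih, Matrix.mul_assoc]

/-- Negation of one bit of a bit string. -/
def flipAt {ι : Type} [DecidableEq ι] (i : ι) (x : ι → Bool) : ι → Bool :=
  Function.update x i (!x i)

theorem flipAt_involutive {ι : Type} [DecidableEq ι] (i : ι) : Function.Involutive (flipAt i) := by
  intro x
  simp [flipAt]

@[simp] theorem flipAt_self {ι : Type} [DecidableEq ι] (i : ι) (x : ι → Bool) :
    flipAt i x i = !x i := by
  simp [flipAt]

theorem onQubit_flipMatrix_apply (q : Q) (x y : Q → Bool) :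
    onQubit q flipMatrix x y = if y = flipAt q x then 1 else 0 := by
  have : y = flipAt q x ↔ (∀ r, r ≠ q → x r = y r) ∧ x q = !y q := by
    constructor
    · rintro rfl
      refine ⟨fun r hr => by simp [flipAt, hr], by simp⟩
    · rintro ⟨h, hq⟩
      funext r
      by_cases hr : r = q
      · subst hr; simp [hq]
      · simp [flipAt, hr, h r hr]
  simp only [onQubit, flipMatrix, this, ite_and]

theorem conj_onQubit_flipMatrix_diag (q : Q) (S : QOp Q) (x : Q → Bool) :
    (onQubit q flipMatrix * S * (onQubit q flipMatrix)ᴴ) x x = S (flipAt q x) (flipAt q x) := by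
  simp [mul_apply, onQubit_flipMatrix_apply, apply_ite]

theorem sum_flipAt {M : Type*} [AddCommMonoid M] (i : Q) (F : (Q → Bool) → M) :
    ∑ x, F (flipAt i x) = ∑ x, F x :=
  Equiv.sum_comp (flipAt_involutive i).toPerm F

/-- Two functions with the same sum over each pair of strings differing in bit `i` have the same
total. -/
theorem sum_eq_of_flipAt (i : Q) {F G : (Q → Bool) → ℝ}
    (h : ∀ x, F x + F (flipAt i x) = G x + G (flipAt i x)) : ∑ x, F x = ∑ x, G x := by
  have := Finset.sum_congr rfl fun x (_ : x ∈ Finset.univ) => h x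
  rw [Finset.sum_add_distrib, Finset.sum_add_distrib, sum_flipAt, sum_flipAt] at this
  linarith

/-- Probability of measuring `b` at the qubit `o` after applying `U` to the state `S`. -/
noncomputable def bornProb (S : QOp Q) (o : Q) (U : QOp Q) (b : Bool) : ℝ :=
  ∑ x, if x o = b then ((U * S * Uᴴ) x x).re else 0

/-- Conjugation by the flip relabels the diagonal entries; reindexing the sum by the same flip moves
the change to the measured value. -/
theorem bornProb_flip (S : QOp Q) (o : Q) (U : QOp Q) (b : Bool) :
    bornProb S o (onQubit o flipMatrix * U) b = bornProb S o U (!b) := by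
  rw [bornProb, bornProb, ← sum_flipAt o]
  refine Finset.sum_congr rfl fun x _ => ?_
  have h : onQubit o flipMatrix * U * S * (onQubit o flipMatrix * U)ᴴ =
      onQubit o flipMatrix * (U * S * Uᴴ) * (onQubit o flipMatrix)ᴴ := by
    simp only [conjTranspose_mul, Matrix.mul_assoc]
  rw [h, conj_onQubit_flipMatrix_diag, flipAt_involutive, flipAt_self]
  cases x o <;> cases b <;> simp

end Unitarity

/-! ### Circuit transformations and their effect on output probabilities. -/

/-- Replace each input bit of an instruction by another input bit or by a constant. -/
def Gate.restrict {m n : ℕ} {Q : Type} (f : Fin m → Fin n ⊕ Bool) : Gate m Q → List (Gate n Q)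
  | .hadamard q => [.hadamard q]
  | .phaseT q => [.phaseT q]
  | .flip q => [.flip q]
  | .cnot c t h => [.cnot c t h]
  | .read j q => (f j).elim (fun j' => [.read j' q]) (fun b => if b then [.flip q] else [])

theorem Gate.length_restrict_le {m n : ℕ} {Q : Type} (f : Fin m → Fin n ⊕ Bool) (g : Gate m Q) :
    (g.restrict f).length ≤ 1 := by
  cases g with
  | read j q =>
    rcases h : f j with j' | (_ | _) <;> simp [Gate.restrict, h]
  | _ => simp [Gate.restrict]

theorem gatesUnitary_gateRestrict {m n : ℕ} {Q : Type} [Fintype Q] [DecidableEq Q]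
    (f : Fin m → Fin n ⊕ Bool) (w : Bits n) (g : Gate m Q) :
    gatesUnitary w (g.restrict f) = g.unitary (fun j => (f j).elim w id) := by
  cases g with
  | read j q =>
    rcases h : f j with j' | (_ | _) <;> simp [Gate.restrict, h, gatesUnitary, Gate.unitary]
  | _ => simp [Gate.restrict, gatesUnitary, Gate.unitary]

theorem gatesUnitary_flatMap_restrict {m n : ℕ} {Q : Type} [Fintype Q] [DecidableEq Q]
    (f : Fin m → Fin n ⊕ Bool) (w : Bits n) (gs : List (Gate m Q)) :
    gatesUnitary w (gs.flatMap (Gate.restrict f)) =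
      gatesUnitary (fun j => (f j).elim w id) gs := by
  induction gs with
  | nil => rfl
  | cons g gs ih =>
    rw [List.flatMap_cons, gatesUnitary_append, ih, gatesUnitary_gateRestrict, gatesUnitary]

theorem length_flatMap_restrict_le {m n : ℕ} {Q : Type} (f : Fin m → Fin n ⊕ Bool)
    (gs : List (Gate m Q)) : (gs.flatMap (Gate.restrict f)).length ≤ gs.length := by
  induction gs with
  | nil => simp
  | cons g gs ih =>
    have := g.length_restrict_le f
    simp only [List.flatMap_cons, List.length_append, List.length_cons]
    omega

namespace QCircuit

variable {m n a : ℕ}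

theorem trace_initialState (C : QCircuit n a) (ρ : QState a) : (C.initialState ρ).trace = 1 := by
  rw [← ρ.trace_eq_one]
  simp only [trace, diag_apply, initialState, and_self]
  rw [← (Equiv.sumArrowEquivProdArrow (Fin a) (Fin C.ancillas) Bool).symm.sum_comp,
    Fintype.sum_prod_type]
  refine Finset.sum_congr rfl fun x _ => ?_
  rw [Finset.sum_eq_single (fun _ => false)]
  · simp [Equiv.sumArrowEquivProdArrow]
  · intro z _ hz
    have : ¬ ∀ r, z r = false := fun h => hz (funext h)
    simp only [Equiv.sumArrowEquivProdArrow, Equiv.coe_fn_symm_mk, Sum.elim_inr]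
    exact if_neg this
  · simp

theorem prob_true_add_prob_false (C : QCircuit n a) (ρ : QState a) (w : Bits n) :
    C.prob ρ w true + C.prob ρ w false = 1 := by
  have ht : (C.finalState ρ w).trace = 1 := by
    -- Cyclicity of the trace brings the adjoint next to the unitary, where they cancel.
    rw [finalState, trace_mul_comm, ← Matrix.mul_assoc, gatesUnitary_isometry, Matrix.one_mul,
      trace_initialState]
  rw [prob, prob, ← Finset.sum_add_distrib, ← Complex.one_re, ← ht, trace, Complex.re_sum]
  refine Finset.sum_congr rfl fun x _ => ?_
  cases x C.output <;> simp

theorem prob_add_prob_not (C : QCircuit n a) (ρ : QState a) (w : Bits n) (b : Bool) :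
    C.prob ρ w b + C.prob ρ w (!b) = 1 := by
  cases b
  · rw [add_comm]; exact C.prob_true_add_prob_false ρ w
  · exact C.prob_true_add_prob_false ρ w

/-- Replace each input bit by another input bit or by a constant. -/
def restrict (C : QCircuit m a) (f : Fin m → Fin n ⊕ Bool) : QCircuit n a where
  ancillas := C.ancillas
  gates := C.gates.flatMap (Gate.restrict f)
  output := C.output

theorem size_restrict_le (C : QCircuit m a) (f : Fin m → Fin n ⊕ Bool) :
    (C.restrict f).size ≤ C.size := by
  have := length_flatMap_restrict_le f C.gates
  simp only [size, restrict]
  omega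

theorem prob_restrict (C : QCircuit m a) (f : Fin m → Fin n ⊕ Bool) (ρ : QState a) (w : Bits n)
    (b : Bool) : (C.restrict f).prob ρ w b = C.prob ρ (fun j => (f j).elim w id) b := by
  change bornProb (C.initialState ρ) C.output (gatesUnitary w (C.gates.flatMap (Gate.restrict f))) b = _
  rw [gatesUnitary_flatMap_restrict]
  rfl

/-- Append an instruction acting on the output qubit. -/
def applyToOutput (C : QCircuit n a) (g : ∀ {Q : Type}, Q → Gate n Q) : QCircuit n a where
  ancillas := C.ancillas
  gates := C.gates ++ [g C.output]
  output := C.output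

theorem size_applyToOutput (C : QCircuit n a) (g : ∀ {Q : Type}, Q → Gate n Q) :
    (C.applyToOutput g).size = C.size + 1 := by
  simp only [size, applyToOutput, List.length_append, List.length_singleton]
  omega

theorem prob_applyToOutput (C : QCircuit n a) (g : ∀ {Q : Type}, Q → Gate n Q) (ρ : QState a)
    (w : Bits n) (b : Bool) : (C.applyToOutput g).prob ρ w b =
      bornProb (C.initialState ρ) C.output ((g C.output).unitary w * gatesUnitary w C.gates) b := by
  change bornProb (C.initialState ρ) C.output (gatesUnitary w (C.gates ++ [g C.output])) b = _
  rw [gatesUnitary_append, gatesUnitary, gatesUnitary, Matrix.one_mul]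

theorem prob_applyToOutput_flip (C : QCircuit n a) (ρ : QState a) (w : Bits n) (b : Bool) :
    (C.applyToOutput .flip).prob ρ w b = C.prob ρ w (!b) := by
  rw [prob_applyToOutput, Gate.unitary, bornProb_flip]
  rfl

theorem prob_applyToOutput_read (C : QCircuit n a) (j : Fin n) (ρ : QState a) (w : Bits n)
    (b : Bool) : (C.applyToOutput (.read j)).prob ρ w b = C.prob ρ w (xor b (w j)) := by
  rw [prob_applyToOutput, Gate.unitary]
  cases w j
  · rw [Bool.xor_false, if_neg Bool.false_ne_true, Matrix.one_mul]
    rfl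
  · rw [Bool.xor_true, if_pos rfl, bornProb_flip]
    rfl

end QCircuit

namespace QPTAlgorithm

theorem prob_add_prob_not (A : QPTAlgorithm) (k : ℕ) {n : ℕ} (w : Bits n) (b : Bool) :
    A.prob k w b + A.prob k w (!b) = 1 :=
  (A.circuit k n).prob_add_prob_not _ _ _

/-- Replace the circuits of an algorithm by others of about the same size. -/
def withCircuit (A : QPTAlgorithm) (F : ∀ k n : ℕ, QCircuit n (A.adviceQubits k))
    (hF : ∀ k n, ∃ m, (F k n).size ≤ (A.circuit k m).size + 2) : QPTAlgorithm where
  adviceQubits := A.adviceQubits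
  advice := A.advice
  circuit := F
  polynomial_size := by
    obtain ⟨p, hp⟩ := A.polynomial_size
    -- `p` bounds the circuits of all input lengths, so the length `m` compared with is irrelevant;
    -- the 2 pays for at most two appended gates.
    refine ⟨p + 2, fun k n => ?_⟩
    obtain ⟨m, hm⟩ := hF k n
    simpa using hm.trans (Nat.add_le_add_right (hp k m) 2)

end QPTAlgorithm

/-! ### Converting predictors into distinguishers and back. -/

/-- From a next-bit predictor, the test whether its prediction of the bit `i k` is correct. -/
theorem exists_nextBitTest (B : QPTAlgorithm) (i : ℕ → ℕ) :
    ∃ A : QPTAlgorithm, ∀ (k n : ℕ) (h : i k < n) (y : Bits n),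
      A.prob k y true = B.prob k (bitsBefore y ⟨i k, h⟩) (y ⟨i k, h⟩) := by
  refine ⟨B.withCircuit (fun k n =>
    if h : i k < n then
      -- The read turns the guess into guess XOR true bit, which is 0 exactly when the guess is
      -- correct; the final flip makes this acceptance.
      (((B.circuit k (i k)).restrict fun j => Sum.inl (Fin.castLE h.le j)).applyToOutput
        (.read ⟨i k, h⟩)).applyToOutput .flip
    -- Dummy for inputs too short to contain the bit. One ancilla guarantees an output qubit even
    -- when there is no advice.
    else ⟨1, [], Sum.inr 0⟩) ?_, ?_⟩
  · intro k n
    refine ⟨i k, ?_⟩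
    split_ifs with h
    · rw [QCircuit.size_applyToOutput, QCircuit.size_applyToOutput]
      exact Nat.add_le_add_right (QCircuit.size_restrict_le _ _) 2
    · simp only [QCircuit.size, List.length_nil]
      omega
  · intro k n h y
    simp only [QPTAlgorithm.prob, QPTAlgorithm.withCircuit, dif_pos h,
      QCircuit.prob_applyToOutput_flip, QCircuit.prob_applyToOutput_read, QCircuit.prob_restrict]
    simp only [Bool.not_true, Bool.false_xor]
    rfl

/-- The string that agrees with `y` before position `t` and with `r` from position `t` on. -/
def hybrid {n : ℕ} (y r : Bits n) (t : ℕ) : Bits n :=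
  fun j => if j.val < t then y j else r j

/-- From a distinguisher, the next-bit predictor that completes the given prefix by fixed bits and
returns the answer of the distinguisher, negated if `c` says so. -/
theorem exists_nextBitPredictor (B : QPTAlgorithm) (ℓ : ℕ → ℕ) (r : ∀ k, ℕ → Bits (ℓ k))
    (c : ℕ → ℕ → Bool) :
    ∃ A : QPTAlgorithm, ∀ (k : ℕ) (i : Fin (ℓ k)) (y : Bits (ℓ k)) (b : Bool),
      A.prob k (bitsBefore y i) b = B.prob k (hybrid y (r k i) i) (xor b (c k i)) := by
  -- The input length `n` tells the predictor which position it predicts, so the hardwired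
  -- completion may depend on that position.
  let R (k n : ℕ) : QCircuit n (B.adviceQubits k) := (B.circuit k (ℓ k)).restrict fun j =>
    if h : j.val < n then Sum.inl ⟨j, h⟩ else Sum.inr (r k n j)
  have hR : ∀ k n, (R k n).size ≤ (B.circuit k (ℓ k)).size := fun k n =>
    QCircuit.size_restrict_le _ _
  refine ⟨B.withCircuit (fun k n => if c k n then (R k n).applyToOutput .flip else R k n) ?_, ?_⟩
  · intro k n
    refine ⟨ℓ k, ?_⟩
    have := hR k n
    split_ifs
    · rw [QCircuit.size_applyToOutput]
      omega
    · omega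
  · intro k i y b
    have hprob : ∀ b, (R k i).prob (B.advice k) (bitsBefore y i) b =
        B.prob k (hybrid y (r k i) i) b := by
      intro b
      rw [QCircuit.prob_restrict, QPTAlgorithm.prob]
      congr 1
      funext j
      by_cases h : j.val < i.val
      · simp only [dif_pos h, hybrid, if_pos h]
        rfl
      · simp only [dif_neg h, hybrid, if_neg h]
        rfl
    simp only [QPTAlgorithm.prob, QPTAlgorithm.withCircuit]
    cases hc : c k i
    · simpa [QPTAlgorithm.prob] using hprob b
    · simpa [QCircuit.prob_applyToOutput_flip, QPTAlgorithm.prob] using hprob (!b)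

/-! ### Pseudorandomness implies next-bit unpredictability. -/

theorem PMF.sum_toReal_eq_one {α : Type*} [Fintype α] (D : PMF α) :
    ∑ y, (D y).toReal = 1 := by
  rw [← ENNReal.toReal_sum fun y _ => D.apply_ne_top y, ← tsum_fintype (L := .unconditional α),
    D.tsum_coe, ENNReal.toReal_one]

theorem toReal_uniformOfFintype_bits {n : ℕ} (y : Bits n) :
    (PMF.uniformOfFintype (Bits n) y).toReal = ((2 : ℝ) ^ n)⁻¹ := by
  simp

/-- Flipping bit `i` leaves the prefix unchanged, so within each such pair of strings the two
success probabilities sum to 1. -/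
theorem guessProb_uniform (B : QPTAlgorithm) (k : ℕ) {n : ℕ} (i : Fin n) :
    guessProb B k (PMF.uniformOfFintype (Bits n)) i = 1 / 2 := by
  have hb : ∀ y : Bits n, bitsBefore (flipAt i y) i = bitsBefore y i := by
    intro y
    funext j
    have : Fin.castLE i.isLt.le j ≠ i := fun h => j.isLt.ne (congrArg Fin.val h)
    simp [bitsBefore, flipAt, this]
  have h := sum_eq_of_flipAt i (F := fun y : Bits n => B.prob k (bitsBefore y i) (y i))
    (G := fun _ => 1 / 2) fun y => by
      simp only [hb, flipAt_self, QPTAlgorithm.prob_add_prob_not]; norm_num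
  simp only [guessProb, toReal_uniformOfFintype_bits]
  rw [← Finset.mul_sum, h]
  simp

theorem nextBitUnpredictableWithin_of_pseudorandomWithin {L : Filter ℕ} {ℓ : ℕ → ℕ}
    {X : Ensemble ℓ} {δ : ℕ → ℝ} (hX : PseudorandomWithin L X δ) :
    NextBitUnpredictableWithin L X δ := by
  intro B
  -- Testing the most predictable position for each `k` bounds all positions at once. If `ℓ k = 0`,
  -- the index is an arbitrary default.
  have hbest : ∀ k, ∃ i : ℕ, ∀ j : Fin (ℓ k), ∃ h : i < ℓ k,
      guessProb B k (X k) j ≤ guessProb B k (X k) ⟨i, h⟩ := by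
    intro k
    rcases isEmpty_or_nonempty (Fin (ℓ k)) with he | hne
    · exact ⟨0, fun j => he.elim j⟩
    · obtain ⟨i, hi⟩ := Finite.exists_max fun j : Fin (ℓ k) => guessProb B k (X k) j
      exact ⟨i, fun j => ⟨i.isLt, hi j⟩⟩
  choose i hi using hbest
  obtain ⟨A, hA⟩ := exists_nextBitTest B i
  filter_upwards [hX A] with k hk j
  obtain ⟨h, hj⟩ := hi k j
  have hacc : ∀ D : PMF (Bits (ℓ k)), acceptProb A k D = guessProb B k D ⟨i k, h⟩ := by
    intro D
    simp only [acceptProb, guessProb, hA k (ℓ k) h]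
  rw [advantage, hacc, hacc, guessProb_uniform] at hk
  linarith [le_abs_self (guessProb B k (X k) ⟨i k, h⟩ - 1 / 2)]

/-! ### The hybrid argument: unpredictability implies pseudorandomness. -/

/-- Probability that the distinguisher `B` accepts the hybrid whose first `t` bits come from `D`
and whose other bits are uniform. -/
noncomputable def hybridProb (B : QPTAlgorithm) (k : ℕ) {n : ℕ} (D : PMF (Bits n)) (t : ℕ) : ℝ :=
  ∑ y : Bits n, (D y).toReal * (((2 : ℝ) ^ n)⁻¹ * ∑ r, B.prob k (hybrid y r t) true)

theorem hybridProb_zero (B : QPTAlgorithm) (k : ℕ) {n : ℕ} (D : PMF (Bits n)) :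
    hybridProb B k D 0 = acceptProb B k (PMF.uniformOfFintype (Bits n)) := by
  have h : ∀ y r : Bits n, hybrid y r 0 = r := fun y r => by funext j; simp [hybrid]
  simp only [hybridProb, h, acceptProb, toReal_uniformOfFintype_bits]
  rw [← Finset.sum_mul, D.sum_toReal_eq_one, one_mul, Finset.mul_sum]

theorem hybridProb_length (B : QPTAlgorithm) (k : ℕ) {n : ℕ} (D : PMF (Bits n)) :
    hybridProb B k D n = acceptProb B k D := by
  have h : ∀ y r : Bits n, hybrid y r n = y := fun y r => by funext j; simp [hybrid]
  simp [hybridProb, h, acceptProb]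

/-- Success probability of the predictor that completes the prefix by `r` and negates the answer of
the distinguisher `B` if `c` says so. -/
noncomputable def predictorProb (B : QPTAlgorithm) (k : ℕ) {n : ℕ} (D : PMF (Bits n)) (i : Fin n)
    (r : Bits n) (c : Bool) : ℝ :=
  ∑ y : Bits n, (D y).toReal * B.prob k (hybrid y r i) (xor (y i) c)

/-- Pair `r` with `flipAt i r`. Let `p` and `q` be the acceptance probabilities of hybrid `i` for
the member agreeing with `y` at `i` and for the other. Hybrid `i + 1` has acceptance probability `p`
for both members, so for `s = false` both sides contribute `p + (1 - q) = 1 + 2p - (p + q)`; `s =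
true` exchanges `p` and `q`. -/
theorem sum_prob_hybrid (B : QPTAlgorithm) (k : ℕ) {n : ℕ} (i : Fin n) (y : Bits n) (s : Bool) :
    ∑ r, B.prob k (hybrid y r i) (xor (y i) (xor (!r i) s)) =
      ∑ r, (1 / 2 + (if s then -1 else 1) *
        (B.prob k (hybrid y r (i + 1)) true - B.prob k (hybrid y r i) true)) := by
  refine sum_eq_of_flipAt i fun r => ?_
  have hsucc : ∀ r, hybrid y r (i + 1) = hybrid y (Function.update r i (y i)) i := by
    intro r
    funext j
    by_cases hj : j = i
    · subst hj; simp [hybrid]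
    · have : j.val ≠ i.val := fun h => hj (Fin.ext h)
      have : j.val < i.val + 1 ↔ j.val < i.val := by omega
      simp [hybrid, hj, this]
  have hfalse : ∀ w : Bits n, B.prob k w false = 1 - B.prob k w true := fun w => by
    linarith [B.prob_add_prob_not k w true, congrArg (B.prob k w) Bool.not_true]
  have hflip : Function.update (flipAt i r) i (y i) = Function.update r i (y i) := by
    simp [flipAt]
  rw [hsucc, hsucc, hflip, flipAt_self]
  rcases Bool.eq_or_eq_not (y i) (r i) with h | h
  · rw [h, Function.update_eq_self]
    cases r i <;> cases s <;> simp [hfalse] <;> ring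
  · have h' : Function.update r i (y i) = flipAt i r := by rw [h]; rfl
    rw [h', h]
    cases r i <;> cases s <;> simp [hfalse] <;> ring

theorem average_predictorProb (B : QPTAlgorithm) (k : ℕ) {n : ℕ} (D : PMF (Bits n)) (i : Fin n)
    (s : Bool) :
    ((2 : ℝ) ^ n)⁻¹ * ∑ r, predictorProb B k D i r (xor (!r i) s) =
      1 / 2 + (if s then -1 else 1) * (hybridProb B k D (i + 1) - hybridProb B k D i) := by
  simp only [predictorProb]
  rw [Finset.sum_comm]
  simp only [← Finset.mul_sum, sum_prob_hybrid, Finset.sum_add_distrib, Finset.sum_sub_distrib]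
  rw [Finset.mul_sum]
  have h1 : (1 : ℝ) / 2 = ∑ y, (D y).toReal * (1 / 2) := by
    rw [← Finset.sum_mul, D.sum_toReal_eq_one, one_mul]
  rw [h1, hybridProb, hybridProb, ← Finset.sum_sub_distrib, Finset.mul_sum,
    ← Finset.sum_add_distrib]
  refine Finset.sum_congr rfl fun y _ => ?_
  have h2 : ((2 : ℝ) ^ n)⁻¹ * 2 ^ n = 1 := inv_mul_cancel₀ (by positivity)
  simp only [← h1, Finset.sum_const, Finset.card_univ, Fintype.card_fun, Fintype.card_bool,
    Fintype.card_fin, nsmul_eq_mul, Nat.cast_pow, Nat.cast_ofNat]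
  linear_combination (D y).toReal / 2 * h2

/-- An average over `r` of quantities bounded by `1/2 + ε` obeys the same bound; the two values of
`s` give the two signs of the gap. -/
theorem abs_hybridProb_succ_sub_le (B : QPTAlgorithm) (k : ℕ) {n : ℕ} (D : PMF (Bits n))
    (i : Fin n) {ε : ℝ} (h : ∀ r c, predictorProb B k D i r c ≤ 1 / 2 + ε) :
    |hybridProb B k D (i + 1) - hybridProb B k D i| ≤ ε := by
  have key : ∀ s : Bool, (1 : ℝ) / 2 + (if s then -1 else 1) *
      (hybridProb B k D (i + 1) - hybridProb B k D i) ≤ 1 / 2 + ε := by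
    intro s
    rw [← average_predictorProb]
    calc ((2 : ℝ) ^ n)⁻¹ * ∑ r, predictorProb B k D i r (xor (!r i) s)
        ≤ ((2 : ℝ) ^ n)⁻¹ * ∑ _r : Bits n, (1 / 2 + ε) := by
          gcongr
          exact h _ _
      _ = 1 / 2 + ε := by
          rw [Finset.sum_const, Finset.card_univ, Fintype.card_fun, Fintype.card_bool,
            Fintype.card_fin, nsmul_eq_mul, Nat.cast_pow, Nat.cast_ofNat,
            inv_mul_cancel_left₀ (by positivity)]
  have h1 := key true
  have h2 := key false
  simp only [if_true, Bool.false_eq_true, if_false] at h1 h2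
  rw [abs_le]
  constructor <;> linarith

theorem pseudorandomWithin_of_nextBitUnpredictableWithin {L : Filter ℕ} {ℓ : ℕ → ℕ}
    {X : Ensemble ℓ} {δ : ℕ → ℝ} (hX : NextBitUnpredictableWithin L X δ) :
    PseudorandomWithin L X (fun k => (ℓ k : ℝ) * δ k) := by
  intro B
  -- The best completion and negation for each prefix length yield one predictor whose success
  -- dominates every choice of `r` and `c`.
  have hbest : ∀ k n : ℕ, ∃ rc : Bits (ℓ k) × Bool, ∀ (h : n < ℓ k) (r : Bits (ℓ k)) (c : Bool),
      predictorProb B k (X k) ⟨n, h⟩ r c ≤ predictorProb B k (X k) ⟨n, h⟩ rc.1 rc.2 := by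
    intro k n
    by_cases h : n < ℓ k
    · obtain ⟨rc, hrc⟩ := Finite.exists_max fun rc : Bits (ℓ k) × Bool =>
        predictorProb B k (X k) ⟨n, h⟩ rc.1 rc.2
      exact ⟨rc, fun _ r c => hrc (r, c)⟩
    · exact ⟨(fun _ => false, false), fun h' => absurd h' h⟩
  choose rc hrc using hbest
  obtain ⟨A, hA⟩ := exists_nextBitPredictor B ℓ (fun k n => (rc k n).1) (fun k n => (rc k n).2)
  filter_upwards [hX A] with k hk
  have hguess : ∀ i : Fin (ℓ k),
      guessProb A k (X k) i = predictorProb B k (X k) i (rc k i).1 (rc k i).2 := by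
    intro i
    simp only [guessProb, predictorProb, hA]
  have hstep : ∀ t ∈ Finset.range (ℓ k),
      |hybridProb B k (X k) (t + 1) - hybridProb B k (X k) t| ≤ δ k := by
    intro t ht
    have htl := Finset.mem_range.1 ht
    refine abs_hybridProb_succ_sub_le B k (X k) ⟨t, htl⟩ fun r c => ?_
    exact (hrc k t htl r c).trans ((hguess ⟨t, htl⟩).symm.trans_le (hk ⟨t, htl⟩))
  -- The uniform distribution and `X k` are the two extreme hybrids, so the advantage is a
  -- telescoping sum of `ℓ k` gaps.
  rw [advantage, ← hybridProb_zero B k (X k), ← hybridProb_length B k (X k),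
    ← Finset.sum_range_sub]
  calc |∑ t ∈ Finset.range (ℓ k), (hybridProb B k (X k) (t + 1) - hybridProb B k (X k) t)|
      ≤ ∑ t ∈ Finset.range (ℓ k), |hybridProb B k (X k) (t + 1) - hybridProb B k (X k) t| :=
        Finset.abs_sum_le_sum_abs _ _
    _ ≤ ∑ _t ∈ Finset.range (ℓ k), δ k := Finset.sum_le_sum hstep
    _ = (ℓ k : ℝ) * δ k := by simp

/-- The two asymptotic readings of "at most `δ`" are both covered: for all security parameters
(`L = ⊤`) and for all sufficiently large ones (`L = atTop`). -/
theorem mainTheorem7 (ℓ : ℕ → ℕ) (X : Ensemble ℓ) (δ : ℕ → ℝ)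
    (L : Filter ℕ) (hL : L = ⊤ ∨ L = atTop) :
    (PseudorandomWithin L X δ → NextBitUnpredictableWithin L X δ) ∧
    (NextBitUnpredictableWithin L X δ → PseudorandomWithin L X (fun k => (ℓ k : ℝ) * δ k)) :=
  ⟨nextBitUnpredictableWithin_of_pseudorandomWithin,
    pseudorandomWithin_of_nextBitUnpredictableWithin⟩
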